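/- Let $H_0,\dots,H_M$ be Hermitian complex $D\times D$ matrices, let $h_0,\dots,h_M$ be real-valued functions of time, let $T\ge 0$, and suppose that $H(t)=\sum_{m=0}^M h_m(t)H_m$ is bounded and piecewise continuous on $[0,T]$. Let $U$ be a continuous matrix-valued function on $[0,T]$ that solves $i\,\frac{d}{dt}U(t)=H(t)U(t)$ (at all but finitely many $t\in[0,T]$) with $U(0)=I$. Let $\mathcal L(\{iH_m\})$ be the real Lie algebra generated by the matrices $iH_0,\dots,iH_M$ under the commutator, and let $\|A\|_F=\sqrt{\operatorname{tr}A^\dagger A}$ be the Frobenius norm. Then there is a Hermitian matrix $C[T]$ such that $$e^{-iC[T]}=U(T),\qquad iC[T]\in\mathcal L(\{iH_m\}),\qquad \|C[T]\|_F\le\int_0^T\|H(t)\|_F\,dt .$$ Consequently, the minimum $c$ of $\|C\|_F$ over all Hermitian $C$ with $iC\in\mathcal L(\{iH_m\})$ and $e^{-iC}=U(T)$ exists and satisfies $c\le T\sup_{0\le t\le T}\|H(t)\|_F$; in particular, if $U(T)\ne I$, then $\sup_{0\le t\le T}\|H(t)\|_F>0$ and $$T\ \ge\ \frac{c}{\sup_{0\le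 t\le T}\|H(t)\|_F}.$$ -/

import Mathlib

noncomputable section

attribute [local instance 100] LieRing.ofAssociativeRing

/-- The Frobenius norm `‖A‖_F = √(tr (A† A))` of a complex square matrix. -/
def frobeniusNorm {D : ℕ} (A : Matrix (Fin D) (Fin D) ℂ) : ℝ :=
  Real.sqrt (Matrix.trace (A.conjTranspose * A)).re

/-- The time-dependent Hamiltonian `H(t) = ∑ m, h m t • H m` with drift/control Hamiltonians
`H 0, …, H M` and real modulations `h 0, …, h M`. -/
def hamiltonian {D M : ℕ} (H : Fin (M + 1) → Matrix (Fin D) (Fin D) ℂ)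
    (h : Fin (M + 1) → ℝ → ℝ) (t : ℝ) : Matrix (Fin D) (Fin D) ℂ :=
  ∑ m, ((h m t : ℝ) : ℂ) • H m

/-- Bounded piecewise continuity on `[0, T]`: `F` is bounded there and continuous away from
finitely many points. A function that is continuous on finitely many pieces with finite one-sided
limits at the break points satisfies this; the existence of the limits is not required. -/
def IsPiecewiseContinuous {D : ℕ} (F : ℝ → Matrix (Fin D) (Fin D) ℂ) (T : ℝ) : Prop :=
  (∃ B : ℝ, ∀ t ∈ Set.Icc (0 : ℝ) T, frobeniusNorm (F t) ≤ B) ∧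
    ∃ S : Set ℝ, S.Finite ∧ ContinuousOn F (Set.Icc (0 : ℝ) T \ S)

/-- `U` solves `i dU/dt = F(t) U(t)`, `U(0) = I` on `[0, T]`, in the usual sense for a piecewise
continuous `F`: `U` is continuous and the equation holds at all but finitely many times. -/
def IsSchrodingerSolution {D : ℕ} (F : ℝ → Matrix (Fin D) (Fin D) ℂ) (T : ℝ)
    (U : ℝ → Matrix (Fin D) (Fin D) ℂ) : Prop :=
  U 0 = 1 ∧ ContinuousOn U (Set.Icc (0 : ℝ) T) ∧
    ∃ S : Set ℝ, S.Finite ∧ ∀ t ∈ Set.Icc (0 : ℝ) T \ S,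
      ∃ U' : Matrix (Fin D) (Fin D) ℂ,
        HasDerivWithinAt U U' (Set.Icc (0 : ℝ) T) t ∧ Complex.I • U' = F t * U t

/-- The dynamical Lie algebra: the real Lie subalgebra of the `D × D` complex matrices, with the
commutator bracket, generated by the matrices `i H m`. -/
def dynamicalLieAlgebra {D M : ℕ} (H : Fin (M + 1) → Matrix (Fin D) (Fin D) ℂ) :
    LieSubalgebra ℝ (Matrix (Fin D) (Fin D) ℂ) :=
  LieSubalgebra.lieSpan ℝ (Matrix (Fin D) (Fin D) ℂ) (Set.range fun m => Complex.I • H m)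

/-- The Hermitian `C` with `i C` in the dynamical Lie algebra and `exp (-i C) = V`. -/
def hermitianGenerators {D M : ℕ} (H : Fin (M + 1) → Matrix (Fin D) (Fin D) ℂ)
    (V : Matrix (Fin D) (Fin D) ℂ) : Set (Matrix (Fin D) (Fin D) ℂ) :=
  {C | C.IsHermitian ∧ NormedSpace.exp (-(Complex.I • C)) = V ∧
    Complex.I • C ∈ dynamicalLieAlgebra H}

end

/-!
Let `B r` be the set of exponentials of elements of norm at most `r` in the Lie algebra `L`. The
heart of the argument is `B r * B s ⊆ B (r + s)`. Write the product as the end of a broken path of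
exponential segments of fixed durations. If two consecutive short segments have different
velocities, the path can be given less energy without moving its end: by ad-invariance the
logarithmic derivative of `exp` at `a` does not affect the inner product with `a`, so the first
variation is that of a Euclidean polygon. A path of least energy therefore has constant velocity and
is a single exponential.

For the solution `U` of `U' = F U` put `ℓ t = ∫ s in 0..t, ‖F s‖`. Over a short step `U` differs
from an exponential segment by `o(Δℓ)`, so the distance from `U t` to `B (ℓ t)` grows by `o(Δℓ)` per
step. Hence `U T` lies in the compact set `B (ℓ T)`.
-/

section

open NormedSpace Filter Topology Set MeasureTheory intervalIntegral

attribute [local instance 100] LieRing.ofAssociativeRing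

section Exponential

variable {𝔸 : Type*} [NormedRing 𝔸] [NormedAlgebra ℝ 𝔸] [CompleteSpace 𝔸]

theorem continuous_exp : Continuous (exp : 𝔸 → 𝔸) :=
  let _ := NormedAlgebra.restrictScalars ℚ ℝ 𝔸
  exp_continuous

theorem contDiff_exp : ContDiff ℝ ⊤ (exp : 𝔸 → 𝔸) :=
  contDiff_iff_contDiffAt.2 fun x => (exp_analytic x).contDiffAt

theorem exp_mul_exp_neg (a : 𝔸) : exp a * exp (-a) = 1 := by
  let _ := NormedAlgebra.restrictScalars ℚ ℝ 𝔸
  rw [← exp_add_of_commute (Commute.refl a).neg_right, add_neg_cancel, exp_zero]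

theorem exp_neg_mul_exp (a : 𝔸) : exp (-a) * exp a = 1 := by
  simpa using exp_mul_exp_neg (-a)

theorem exp_add_smul (a : 𝔸) (s t : ℝ) : exp ((s + t) • a) = exp (s • a) * exp (t • a) := by
  let _ := NormedAlgebra.restrictScalars ℚ ℝ 𝔸
  rw [add_smul, exp_add_of_commute (((Commute.refl a).smul_left s).smul_right t)]

theorem exp_neg_eq_mul_of_exp_eq_mul {a b c : 𝔸} (h : exp c = exp a * exp b) :
    exp (-c) = exp (-b) * exp (-a) := by
  refine left_inv_eq_right_inv (exp_neg_mul_exp c) ?_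
  rw [h, mul_assoc, ← mul_assoc (exp b), exp_mul_exp_neg, one_mul, exp_mul_exp_neg]

theorem hasDerivAt_exp_neg_smul (a : 𝔸) (t : ℝ) :
    HasDerivAt (fun s : ℝ => exp (-(s • a))) (-(a * exp (-(t • a)))) t := by
  simpa using hasDerivAt_exp_smul_const' (-a) t

theorem continuous_exp_neg_smul_mul_mul_exp_smul (a b y : 𝔸) :
    Continuous fun t : ℝ => exp (-(t • a)) * y * exp (t • b) := by
  have := continuous_exp (𝔸 := 𝔸)
  fun_prop

theorem hasDerivAt_exp_neg_smul_mul_exp_smul (a b : 𝔸) (t : ℝ) :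
    HasDerivAt (fun t : ℝ => exp (-(t • a)) * exp (t • b))
      (exp (-(t • a)) * (b - a) * exp (t • b)) t := by
  refine ((hasDerivAt_exp_neg_smul a t).fun_mul (hasDerivAt_exp_smul_const' b t)).congr_deriv ?_
  rw [((Commute.refl a).smul_right t).neg_right.exp_right.eq]
  noncomm_ring

theorem exp_neg_mul_exp_add (a y : 𝔸) :
    exp (-a) * exp (a + y) = 1 + ∫ t in (0 : ℝ)..1, exp (-(t • a)) * y * exp (t • (a + y)) := by
  have h := integral_eq_sub_of_hasDerivAt (a := 0) (b := 1)
    (fun t _ => hasDerivAt_exp_neg_smul_mul_exp_smul a (a + y) t)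
    ((continuous_exp_neg_smul_mul_mul_exp_smul ..).intervalIntegrable _ _)
  simp only [add_sub_cancel_left] at h
  rw [h]
  simp

theorem fderiv_exp_apply (a y : 𝔸) :
    fderiv ℝ exp a y = exp a * ∫ t in (0 : ℝ)..1, exp (-(t • a)) * y * exp (t • a) := by
  set G : ℝ → 𝔸 := fun s => ∫ t in (0 : ℝ)..1, exp (-(t • a)) * y * exp (t • (a + s • y)) with hG
  have hG_cont : Continuous G := by
    apply continuous_parametric_intervalIntegral_of_continuous'
    have := continuous_exp (𝔸 := 𝔸)
    simp only [Function.uncurry_def]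
    fun_prop
  have duhamel (s : ℝ) : exp (a + s • y) = exp a * (1 + s • G s) := by
    have h := exp_neg_mul_exp_add a (s • y)
    simp only [mul_smul_comm, smul_mul_assoc, intervalIntegral.integral_smul] at h
    rw [hG, ← h, ← mul_assoc, exp_mul_exp_neg, one_mul]
  have hderiv_smul : HasDerivAt (fun s : ℝ => s • G s) (G 0) 0 := by
    rw [hasDerivAt_iff_tendsto_slope]
    refine Tendsto.congr' ?_ ((hG_cont.tendsto 0).mono_left nhdsWithin_le_nhds)
    filter_upwards [self_mem_nhdsWithin] with s (hs : s ≠ 0)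
    simp [slope_def_module, smul_smul, hs]
  have hderiv_line : HasDerivAt (fun s : ℝ => exp (a + s • y)) (fderiv ℝ exp a y) 0 := by
    have hline : HasDerivAt (fun s : ℝ => a + s • y) y 0 := by
      simpa using ((hasDerivAt_id (0 : ℝ)).smul_const y).const_add a
    refine HasFDerivAt.comp_hasDerivAt (0 : ℝ) ?_ hline
    simpa using (contDiff_exp.differentiable (by simp) a).hasFDerivAt
  simp only [duhamel] at hderiv_line
  rw [hderiv_line.unique ((hderiv_smul.const_add 1).const_mul (exp a))]
  simp [hG]

/-- The left logarithmic derivative of the exponential at `a`: a differentiable curve `c` satisfies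
`(exp ∘ c)' = exp c * expLogDeriv c c'`. -/
noncomputable def expLogDeriv (a : 𝔸) : 𝔸 →L[ℝ] 𝔸 :=
  (ContinuousLinearMap.mul ℝ 𝔸 (exp (-a))).comp (fderiv ℝ exp a)

theorem expLogDeriv_apply (a y : 𝔸) :
    expLogDeriv a y = ∫ t in (0 : ℝ)..1, exp (-(t • a)) * y * exp (t • a) := by
  change exp (-a) * fderiv ℝ exp a y = _
  rw [fderiv_exp_apply, ← mul_assoc, exp_neg_mul_exp, one_mul]

theorem exp_mul_expLogDeriv (a y : 𝔸) : exp a * expLogDeriv a y = fderiv ℝ exp a y := by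
  change exp a * (exp (-a) * fderiv ℝ exp a y) = _
  rw [← mul_assoc, exp_mul_exp_neg, one_mul]

theorem expLogDeriv_zero : expLogDeriv (0 : 𝔸) = ContinuousLinearMap.id ℝ 𝔸 := by
  ext y
  simp [expLogDeriv_apply]

theorem contDiff_expLogDeriv : ContDiff ℝ 1 (expLogDeriv : 𝔸 → 𝔸 →L[ℝ] 𝔸) := by
  have hmul : ContDiff ℝ 1 fun a : 𝔸 => ContinuousLinearMap.mul ℝ 𝔸 (exp (-a)) :=
    (ContinuousLinearMap.mul ℝ 𝔸).contDiff.comp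
      ((contDiff_exp.of_le (by simp)).comp contDiff_neg)
  exact hmul.clm_comp (contDiff_exp.fderiv_right (by simp))

theorem exp_eq_exp_mul_exp_smul_of_expLogDeriv_eq {c v : ℝ → 𝔸} {x : 𝔸} {ε : ℝ}
    (hc : ∀ t ∈ Metric.ball (0 : ℝ) ε, HasDerivAt c (v t) t)
    (hv : ∀ t ∈ Metric.ball (0 : ℝ) ε, expLogDeriv (c t) (v t) = x) {t : ℝ}
    (ht : t ∈ Metric.ball (0 : ℝ) ε) : exp (c t) = exp (c 0) * exp (t • x) := by
  have hderiv : ∀ t ∈ Metric.ball (0 : ℝ) ε,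
      HasDerivAt (fun t : ℝ => exp (c t) * exp (-(t • x))) 0 t := by
    intro t ht
    have hexp : HasDerivAt (fun t => exp (c t)) (exp (c t) * x) t := by
      rw [← hv t ht, exp_mul_expLogDeriv]
      exact (contDiff_exp.differentiable (by simp) (c t)).hasFDerivAt.comp_hasDerivAt t (hc t ht)
    refine (hexp.fun_mul (hasDerivAt_exp_neg_smul x t)).congr_deriv ?_
    noncomm_ring
  have hconst := Metric.isOpen_ball.is_const_of_deriv_eq_zero
    (convex_ball (0 : ℝ) ε).isPreconnected
    (fun t ht => (hderiv t ht).differentiableAt.differentiableWithinAt)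
    (fun t ht => (hderiv t ht).deriv) ht (Metric.mem_ball_self (Metric.pos_of_mem_ball ht))
  simp only [zero_smul, neg_zero, exp_zero, mul_one] at hconst
  rw [← hconst, mul_assoc, exp_neg_mul_exp, mul_one]

end Exponential

section Submodule

variable {E : Type*} [NormedAddCommGroup E] [NormedSpace ℝ E] [CompleteSpace E]

theorem intervalIntegral_mem_submodule {S : Submodule ℝ E} [FiniteDimensional ℝ S] {f : ℝ → E}
    {a b : ℝ} (hf : ∀ t ∈ uIcc a b, f t ∈ S) (hfi : IntervalIntegrable f volume a b) :
    ∫ t in a..b, f t ∈ S := by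
  obtain ⟨Q, hQ⟩ := Submodule.ClosedComplemented.of_finiteDimensional S
  have hproj : ∫ t in a..b, f t = S.subtypeL.comp Q (∫ t in a..b, f t) := by
    rw [← ContinuousLinearMap.intervalIntegral_comp_comm _ hfi]
    exact integral_congr fun t ht => congrArg Subtype.val (hQ ⟨f t, hf t ht⟩).symm
  rw [hproj]
  exact Subtype.property _

theorem exp_apply_mem_of_invariant {S : Submodule ℝ E} [FiniteDimensional ℝ S] {D : E →L[ℝ] E}
    (hD : ∀ x ∈ S, D x ∈ S) {x : E} (hx : x ∈ S) : exp D x ∈ S := by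
  have hsum := (exp_series_hasSum_exp' (𝕂 := ℝ) D).mapL (ContinuousLinearMap.apply ℝ E x)
  have hpow (n : ℕ) : (D ^ n) x ∈ S := by
    induction n with
    | zero => exact hx
    | succ n ih => rw [pow_succ']; exact hD _ ih
  exact S.closed_of_finiteDimensional.mem_of_tendsto hsum <|
    Eventually.of_forall fun s => S.sum_mem fun n _ => S.smul_mem _ (hpow n)

end Submodule

section LieSubalgebra

variable {𝔸 : Type*} [NormedRing 𝔸] [NormedAlgebra ℝ 𝔸] [CompleteSpace 𝔸]

theorem hasDerivAt_exp_neg_smul_mul_mul_exp_smul (a y : 𝔸) (t : ℝ) :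
    HasDerivAt (fun t : ℝ => exp (-(t • a)) * y * exp (t • a))
      (-⁅a, exp (-(t • a)) * y * exp (t • a)⁆) t := by
  refine (((hasDerivAt_exp_neg_smul a t).mul_const y).fun_mul
    (hasDerivAt_exp_smul_const a t)).congr_deriv ?_
  rw [LieRing.of_associative_ring_bracket]
  noncomm_ring

variable {L : LieSubalgebra ℝ 𝔸} {a y : 𝔸}

theorem exp_neg_smul_mul_mul_exp_smul_mem [FiniteDimensional ℝ L] (ha : a ∈ L) (hy : y ∈ L)
    (t : ℝ) : exp (-(t • a)) * y * exp (t • a) ∈ L := by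
  have : FiniteDimensional ℝ L.toSubmodule := ‹_›
  let D : 𝔸 →L[ℝ] 𝔸 := -(ContinuousLinearMap.mul ℝ 𝔸 a - (ContinuousLinearMap.mul ℝ 𝔸).flip a)
  have hD : ∀ z ∈ L.toSubmodule, D z ∈ L.toSubmodule := fun z hz => L.neg_mem (L.lie_mem ha hz)
  have heq : (fun t : ℝ => exp (-(t • a)) * y * exp (t • a)) = fun t => exp (t • D) y := by
    refine ODE_solution_unique_univ (v := fun _ => D) (s := fun _ => univ) (t₀ := 0)
      (fun _ => D.lipschitz.lipschitzOnWith) (fun t => ⟨?_, mem_univ _⟩)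
      (fun t => ⟨?_, mem_univ _⟩)
      (by simp [zero_smul ℝ D])
    · exact hasDerivAt_exp_neg_smul_mul_mul_exp_smul a y t
    · exact (ContinuousLinearMap.apply ℝ 𝔸 y).hasFDerivAt.comp_hasDerivAt t
        (hasDerivAt_exp_smul_const' D t)
  rw [congrFun heq t]
  exact exp_apply_mem_of_invariant (fun z hz => L.smul_mem t (hD z hz)) hy

theorem expLogDeriv_mem [FiniteDimensional ℝ L] (ha : a ∈ L) (hy : y ∈ L) :
    expLogDeriv a y ∈ L := by
  have : FiniteDimensional ℝ L.toSubmodule := ‹_›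
  rw [expLogDeriv_apply]
  exact intervalIntegral_mem_submodule
    (fun t _ => exp_neg_smul_mul_mul_exp_smul_mem ha hy t)
    ((continuous_exp_neg_smul_mul_mul_exp_smul ..).intervalIntegrable _ _)

theorem apply_expLogDeriv [FiniteDimensional ℝ L] (ha : a ∈ L) (hy : y ∈ L) {φ : 𝔸 →L[ℝ] ℝ}
    (hφ : ∀ z ∈ L, φ ⁅a, z⁆ = 0) : φ (expLogDeriv a y) = φ y := by
  have hconst (t : ℝ) : φ (exp (-(t • a)) * y * exp (t • a)) = φ y := by
    have hderiv (t : ℝ) : HasDerivAt (fun t : ℝ => φ (exp (-(t • a)) * y * exp (t • a))) 0 t := by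
      refine (φ.hasFDerivAt.comp_hasDerivAt t
        (hasDerivAt_exp_neg_smul_mul_mul_exp_smul a y t)).congr_deriv ?_
      rw [map_neg, hφ _ (exp_neg_smul_mul_mul_exp_smul_mem ha hy t), neg_zero]
    simpa using is_const_of_deriv_eq_zero (fun t => (hderiv t).differentiableAt)
      (fun t => (hderiv t).deriv) t 0
  rw [expLogDeriv_apply, ← φ.intervalIntegral_comp_comm
    ((continuous_exp_neg_smul_mul_mul_exp_smul ..).intervalIntegrable _ _)]
  simp [hconst]

end LieSubalgebra

section LocalLogarithm

variable {𝔸 : Type*} [NormedRing 𝔸] [NormedAlgebra ℝ 𝔸] [CompleteSpace 𝔸]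
variable (L : LieSubalgebra ℝ 𝔸) [FiniteDimensional ℝ L]

theorem exists_vectorField_expLogDeriv_eq :
    ∃ δ > (0 : ℝ), ∀ x ∈ L, ∃ V : L.toSubmodule → L.toSubmodule,
      ∀ a ∈ Metric.ball 0 δ, ContDiffAt ℝ 1 V a ∧ expLogDeriv (a : 𝔸) (V a : 𝔸) = x := by
  have : FiniteDimensional ℝ L.toSubmodule := ‹_›
  have := FiniteDimensional.complete ℝ L.toSubmodule
  obtain ⟨Q, hQ⟩ := Submodule.ClosedComplemented.of_finiteDimensional L.toSubmodule
  let J (a : L.toSubmodule) : L.toSubmodule →L[ℝ] L.toSubmodule :=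
    Q.comp ((expLogDeriv (a : 𝔸)).comp L.toSubmodule.subtypeL)
  have hJ_coe (a v : L.toSubmodule) : (J a v : 𝔸) = expLogDeriv (a : 𝔸) (v : 𝔸) :=
    congrArg Subtype.val (hQ ⟨_, expLogDeriv_mem a.2 v.2⟩)
  have hJ_contDiff : ContDiff ℝ 1 J := contDiff_const.clm_comp
    ((contDiff_expLogDeriv.comp L.toSubmodule.subtypeL.contDiff).clm_comp contDiff_const)
  have hJ_zero : J 0 = ContinuousLinearMap.id ℝ _ := by
    ext v
    simp [hJ_coe, expLogDeriv_zero]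
  have hJ_inv : ∀ᶠ a in 𝓝 0, (J a).IsInvertible := by
    refine hJ_contDiff.continuous.continuousAt.eventually (p := (·.IsInvertible)) ?_
    rw [hJ_zero]
    exact (ContinuousLinearEquiv.refl ℝ L.toSubmodule).nhds
  obtain ⟨δ, hδ, hball⟩ := Metric.eventually_nhds_iff_ball.1 hJ_inv
  refine ⟨δ, hδ, fun x hx => ⟨fun a => (J a).inverse ⟨x, hx⟩, fun a ha => ⟨?_, ?_⟩⟩⟩
  · exact ((hball a ha).contDiffAt_map_inverse.comp a hJ_contDiff.contDiffAt).clm_apply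
      contDiffAt_const
  · rw [← hJ_coe, (hball a ha).self_apply_inverse]

theorem exists_curve_exp_eq_exp_mul_exp_smul :
    ∃ δ > (0 : ℝ), ∀ a ∈ L, ‖a‖ < δ → ∀ x ∈ L, ∃ c : ℝ → 𝔸, ∃ v ∈ L, (∀ s, c s ∈ L) ∧ c 0 = a ∧
      (∀ᶠ s in 𝓝 (0 : ℝ), exp (c s) = exp a * exp (s • x)) ∧
      HasDerivAt c v 0 ∧ expLogDeriv a v = x := by
  have : FiniteDimensional ℝ L.toSubmodule := ‹_›
  have := FiniteDimensional.complete ℝ L.toSubmodule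
  obtain ⟨δ, hδ, hfield⟩ := exists_vectorField_expLogDeriv_eq L
  refine ⟨δ, hδ, fun a ha haδ x hx => ?_⟩
  obtain ⟨V, hV⟩ := hfield x hx
  have ha_ball : (⟨a, ha⟩ : L.toSubmodule) ∈ Metric.ball 0 δ := mem_ball_zero_iff.2 haδ
  obtain ⟨α, hα_zero, ε, hε, hα⟩ :=
    (hV _ ha_ball).1.exists_forall_mem_closedBall_exists_eq_forall_mem_Ioo_hasDerivAt₀ 0
  simp only [zero_sub, zero_add] at hα
  have hα_ball : ∀ᶠ t in 𝓝 0, α t ∈ Metric.ball 0 δ :=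
    (hα 0 ⟨neg_lt_zero.2 hε, hε⟩).continuousAt.eventually_mem
      (hα_zero ▸ Metric.isOpen_ball.mem_nhds ha_ball)
  obtain ⟨ρ, hρ, hball⟩ := Metric.eventually_nhds_iff_ball.1
    (hα_ball.and (Ioo_mem_nhds (neg_lt_zero.2 hε) hε))
  have hα_deriv : ∀ t ∈ Metric.ball 0 ρ, HasDerivAt (fun t => (α t : 𝔸)) (V (α t)) t :=
    fun t ht => L.toSubmodule.subtypeL.hasFDerivAt.comp_hasDerivAt t (hα t (hball t ht).2)
  refine ⟨fun t => α t, V ⟨a, ha⟩, (V _).2, fun s => (α s).2, by simp [hα_zero], ?_, ?_,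
    (hV _ ha_ball).2⟩
  · filter_upwards [Metric.ball_mem_nhds 0 hρ] with s hs
    simpa [hα_zero] using exp_eq_exp_mul_exp_smul_of_expLogDeriv_eq hα_deriv
      (fun t ht => (hV _ (hball t ht).1).2) hs
  · simpa [hα_zero] using hα_deriv 0 (Metric.mem_ball_self hρ)

end LocalLogarithm

section AdInvariantInner

variable {𝔸 : Type*} [NormedRing 𝔸] [NormedAlgebra ℝ 𝔸]

/-- On `L` the bilinear form `B` is an inner product inducing the norm, and it is invariant under
the adjoint action. Invariance is only asked for in the form `B x ⁅x, y⁆ = 0`, that is, the action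
of `ad y` is infinitesimally isometric. -/
structure IsAdInvariantInner (L : LieSubalgebra ℝ 𝔸) (B : 𝔸 →L[ℝ] 𝔸 →L[ℝ] ℝ) : Prop where
  apply_self : ∀ x ∈ L, B x x = ‖x‖ ^ 2
  symm : ∀ x ∈ L, ∀ y ∈ L, B x y = B y x
  apply_lie_self : ∀ x ∈ L, ∀ y ∈ L, B x ⁅x, y⁆ = 0

variable [CompleteSpace 𝔸] {L : LieSubalgebra ℝ 𝔸} [FiniteDimensional ℝ L]
  {B : 𝔸 →L[ℝ] 𝔸 →L[ℝ] ℝ}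

namespace IsAdInvariantInner

-- First variation: `B a c'(0) = B a x`, since the logarithmic derivative at `a` preserves `B a`.
theorem exists_curve_mul_exp_smul (hB : IsAdInvariantInner L B) :
    ∃ δ > (0 : ℝ), ∀ a ∈ L, ‖a‖ < δ → ∀ x ∈ L, ∃ c : ℝ → 𝔸, (∀ s, c s ∈ L) ∧ c 0 = a ∧
      (∀ᶠ s in 𝓝 (0 : ℝ), exp (c s) = exp a * exp (s • x)) ∧
      HasDerivAt (fun s => ‖c s‖ ^ 2) (2 * B a x) 0 := by
  obtain ⟨δ, hδ, hcurve⟩ := exists_curve_exp_eq_exp_mul_exp_smul L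
  refine ⟨δ, hδ, fun a ha haδ x hx => ?_⟩
  obtain ⟨c, v, hv, hcL, hc_zero, hc_exp, hc_deriv, rfl⟩ := hcurve a ha haδ x hx
  refine ⟨c, hcL, hc_zero, hc_exp, ?_⟩
  have hderiv : HasDerivAt (fun s => B (c s) (c s)) (B v (c 0) + B (c 0) v) 0 :=
    (B.hasFDerivAt.comp_hasDerivAt (0 : ℝ) hc_deriv).clm_apply hc_deriv
  simp only [hB.apply_self _ (hcL _)] at hderiv
  refine hderiv.congr_deriv ?_
  rw [hc_zero, hB.symm v hv a ha, apply_expLogDeriv ha hv (hB.apply_lie_self a ha), two_mul]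

theorem exists_curve_exp_neg_smul_mul (hB : IsAdInvariantInner L B) :
    ∃ δ > (0 : ℝ), ∀ a ∈ L, ‖a‖ < δ → ∀ x ∈ L, ∃ c : ℝ → 𝔸, (∀ s, c s ∈ L) ∧ c 0 = a ∧
      (∀ᶠ s in 𝓝 (0 : ℝ), exp (c s) = exp (-(s • x)) * exp a) ∧
      HasDerivAt (fun s => ‖c s‖ ^ 2) (-(2 * B a x)) 0 := by
  obtain ⟨δ, hδ, hcurve⟩ := hB.exists_curve_mul_exp_smul
  refine ⟨δ, hδ, fun a ha haδ x hx => ?_⟩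
  obtain ⟨c, hcL, hc_zero, hc_exp, hc_deriv⟩ :=
    hcurve (-a) (L.neg_mem ha) (by rwa [norm_neg]) x hx
  refine ⟨fun s => -c s, fun s => L.neg_mem (hcL s), by simp [hc_zero], ?_, by simpa using hc_deriv⟩
  filter_upwards [hc_exp] with s hs
  simpa using exp_neg_eq_mul_of_exp_eq_mul hs

-- Two consecutive segments with different velocities are shortened by moving their common vertex
-- in the direction of the velocity difference.
theorem exists_energy_lt (hB : IsAdInvariantInner L B) :
    ∃ δ > (0 : ℝ), ∀ v w : ℝ, ∀ a ∈ L, ∀ b ∈ L, ‖a‖ < δ → ‖b‖ < δ → v⁻¹ • a ≠ w⁻¹ • b →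
      ∃ a' ∈ L, ∃ b' ∈ L, ‖a'‖ < δ ∧ ‖b'‖ < δ ∧ exp a' * exp b' = exp a * exp b ∧
        ‖a'‖ ^ 2 / v + ‖b'‖ ^ 2 / w < ‖a‖ ^ 2 / v + ‖b‖ ^ 2 / w := by
  obtain ⟨δ₁, hδ₁, hright⟩ := hB.exists_curve_mul_exp_smul
  obtain ⟨δ₂, hδ₂, hleft⟩ := hB.exists_curve_exp_neg_smul_mul
  have hδ := lt_min hδ₁ hδ₂
  refine ⟨min δ₁ δ₂, hδ, fun v w a ha b hb haδ hbδ hne => ?_⟩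
  let x := v⁻¹ • a - w⁻¹ • b
  have hxL : x ∈ L := L.sub_mem (L.smul_mem _ ha) (L.smul_mem _ hb)
  obtain ⟨c, hcL, hc_zero, hc_exp, hc_deriv⟩ := hright a ha (haδ.trans_le (min_le_left ..)) x hxL
  obtain ⟨d, hdL, hd_zero, hd_exp, hd_deriv⟩ := hleft b hb (hbδ.trans_le (min_le_right ..)) x hxL
  have henergy : HasDerivAt (fun s => ‖c s‖ ^ 2 / v + ‖d s‖ ^ 2 / w) (2 * ‖x‖ ^ 2) 0 := by
    refine ((hc_deriv.div_const v).add (hd_deriv.div_const w)).congr_deriv ?_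
    have hB_sub (z : 𝔸) : B (v⁻¹ • a - w⁻¹ • b) z = v⁻¹ * B a z - w⁻¹ * B b z := by simp
    rw [← hB.apply_self x hxL, hB_sub x]
    ring
  have hnot_min : ¬ IsLocalMin (fun s => ‖c s‖ ^ 2 / v + ‖d s‖ ^ 2 / w) 0 := fun hmin => by
    simpa [x, sub_eq_zero, hne] using hmin.hasDerivAt_eq_zero henergy
  have hcδ : ∀ᶠ s in 𝓝 (0 : ℝ), ‖c s‖ ^ 2 < min δ₁ δ₂ ^ 2 :=
    hc_deriv.continuousAt.eventually_lt continuousAt_const (by rw [hc_zero]; gcongr)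
  have hdδ : ∀ᶠ s in 𝓝 (0 : ℝ), ‖d s‖ ^ 2 < min δ₁ δ₂ ^ 2 :=
    hd_deriv.continuousAt.eventually_lt continuousAt_const (by rw [hd_zero]; gcongr)
  obtain ⟨s, hs_lt, hs_c, hs_d, hs_cδ, hs_dδ⟩ := ((Filter.not_eventually.1 hnot_min).and_eventually
    (hc_exp.and (hd_exp.and (hcδ.and hdδ)))).exists
  refine ⟨c s, hcL s, d s, hdL s, lt_of_pow_lt_pow_left₀ 2 hδ.le hs_cδ,
    lt_of_pow_lt_pow_left₀ 2 hδ.le hs_dδ, ?_, by simpa [hc_zero, hd_zero] using hs_lt⟩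
  rw [hs_c, hs_d, mul_assoc, ← mul_assoc (exp (s • x)), exp_mul_exp_neg, one_mul]

end IsAdInvariantInner

end AdInvariantInner

section ExpChain

variable {𝔸 : Type*} [NormedRing 𝔸]

/-- The ordered product `exp (a 0) * exp (a 1) * ⋯ * exp (a (n - 1))`: the end point of the broken
path which runs along the one-parameter segments `exp (t • a i)`, `0 ≤ t ≤ 1`. -/
noncomputable def expChain (a : ℕ → 𝔸) : ℕ → 𝔸
  | 0 => 1
  | n + 1 => expChain a n * exp (a n)

theorem expChain_congr {a b : ℕ → 𝔸} {n : ℕ} (h : ∀ i < n, a i = b i) :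
    expChain a n = expChain b n := by
  induction n with
  | zero => rfl
  | succ n ih => rw [expChain, expChain, ih fun i hi => h i (by omega), h n n.lt_succ_self]

theorem expChain_add (a : ℕ → 𝔸) (n m : ℕ) :
    expChain a (n + m) = expChain a n * expChain (fun i => a (n + i)) m := by
  induction m with
  | zero => exact (mul_one _).symm
  | succ m ih => rw [← add_assoc, expChain, ih, expChain, mul_assoc]

theorem expChain_eq_of_adjacent {a b : ℕ → 𝔸} {i n : ℕ} (hi : i + 2 ≤ n)
    (h : ∀ j, j ≠ i → j ≠ i + 1 → b j = a j)
    (hmul : exp (b i) * exp (b (i + 1)) = exp (a i) * exp (a (i + 1))) :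
    expChain b n = expChain a n := by
  obtain ⟨m, rfl⟩ := Nat.exists_eq_add_of_le hi
  have hpair : expChain b (i + 2) = expChain a (i + 2) := by
    simp only [expChain, mul_assoc, hmul]
    rw [expChain_congr fun j hj => h j (by omega) (by omega)]
  rw [expChain_add b, expChain_add a, hpair,
    expChain_congr fun j _ => h (i + 2 + j) (by omega) (by omega)]

variable [NormedAlgebra ℝ 𝔸] [CompleteSpace 𝔸]

theorem expChain_smul (w : ℕ → ℝ) (x : 𝔸) (n : ℕ) :
    expChain (fun i => w i • x) n = exp ((∑ i ∈ Finset.range n, w i) • x) := by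
  induction n with
  | zero => simp [expChain]
  | succ n ih => rw [expChain, ih, Finset.sum_range_succ, exp_add_smul]

theorem expChain_append_smul_inv {k : ℕ} (hk : k ≠ 0) (x y : 𝔸) :
    expChain (fun i => (k : ℝ)⁻¹ • if i < k then x else y) (k + k) = exp x * exp y := by
  have hconst (z : 𝔸) : expChain (fun _ => (k : ℝ)⁻¹ • z) k = exp z := by
    rw [expChain_smul (fun _ => (k : ℝ)⁻¹)]
    simp [hk]
  rw [expChain_add, ← hconst x, ← hconst y]
  congr 1 <;> exact expChain_congr fun i hi => by simp [hi]

theorem continuous_expChain (n : ℕ) : Continuous fun a : ℕ → 𝔸 => expChain a n := by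
  induction n with
  | zero => exact continuous_const
  | succ n ih => exact ih.mul (continuous_exp.comp (continuous_apply n))

end ExpChain

section ChainEnergy

variable {E : Type*} [NormedAddCommGroup E]

/-- The energy `∫ ‖velocity‖²` of the broken path of `expChain a n` when its `i`-th segment is run
through with constant velocity in time `w i`. -/
noncomputable def chainEnergy (w : ℕ → ℝ) (n : ℕ) (a : ℕ → E) : ℝ :=
  ∑ i ∈ Finset.range n, ‖a i‖ ^ 2 / w i

theorem norm_sq_le_mul_chainEnergy {w : ℕ → ℝ} (hw : ∀ i, 0 < w i) {n i : ℕ} (hi : i < n)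
    (a : ℕ → E) : ‖a i‖ ^ 2 ≤ w i * chainEnergy w n a := by
  rw [← div_le_iff₀' (hw i)]
  exact Finset.single_le_sum (f := fun i => ‖a i‖ ^ 2 / w i)
    (fun j _ => div_nonneg (sq_nonneg _) (hw j).le) (Finset.mem_range.2 hi)

theorem chainEnergy_sub_chainEnergy_of_adjacent (w : ℕ → ℝ) {a b : ℕ → E} {i n : ℕ}
    (hi : i + 2 ≤ n) (h : ∀ j, j ≠ i → j ≠ i + 1 → b j = a j) :
    chainEnergy w n b - chainEnergy w n a =
      (‖b i‖ ^ 2 / w i + ‖b (i + 1)‖ ^ 2 / w (i + 1)) -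
        (‖a i‖ ^ 2 / w i + ‖a (i + 1)‖ ^ 2 / w (i + 1)) := by
  rw [chainEnergy, chainEnergy, ← Finset.sum_sub_distrib, Finset.sum_eq_add_of_mem i (i + 1)
    (Finset.mem_range.2 (by omega)) (Finset.mem_range.2 (by omega)) (by omega)]
  · ring
  · intro j _ hj
    rw [h j hj.1 hj.2, sub_self]

theorem chainEnergy_smul [NormedSpace ℝ E] {w : ℕ → ℝ} (hw : ∀ i, 0 < w i) (x : E) (n : ℕ) :
    chainEnergy w n (fun i => w i • x) = (∑ i ∈ Finset.range n, w i) * ‖x‖ ^ 2 := by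
  rw [chainEnergy, Finset.sum_mul]
  refine Finset.sum_congr rfl fun i _ => ?_
  have := (hw i).ne'
  rw [norm_smul, Real.norm_of_nonneg (hw i).le]
  field

theorem exists_isMinOn_chainEnergy {𝔸 : Type*} [NormedRing 𝔸] [NormedAlgebra ℝ 𝔸]
    [CompleteSpace 𝔸] {K : Set 𝔸} (hK : IsCompact K) (w : ℕ → ℝ) (n : ℕ)
    {b : ℕ → 𝔸} (hb : ∀ i, b i ∈ K) :
    ∃ a ∈ {a | (∀ i, a i ∈ K) ∧ expChain a n = expChain b n},
      IsMinOn (chainEnergy w n) {a | (∀ i, a i ∈ K) ∧ expChain a n = expChain b n} a := by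
  have hcompact : IsCompact {a | (∀ i, a i ∈ K) ∧ expChain a n = expChain b n} :=
    (isCompact_pi_infinite fun _ => hK).inter_right
      (isClosed_eq (continuous_expChain n) continuous_const)
  refine hcompact.exists_isMinOn ⟨b, hb, rfl⟩ (Continuous.continuousOn ?_)
  unfold chainEnergy
  fun_prop

end ChainEnergy

section ExpBall

theorem isCompact_closedBall_inter_submodule {E : Type*} [NormedAddCommGroup E] [NormedSpace ℝ E]
    (S : Submodule ℝ E) [FiniteDimensional ℝ S] (r : ℝ) :
    IsCompact (Metric.closedBall (0 : E) r ∩ S) := by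
  have := FiniteDimensional.proper ℝ S
  have himage : Metric.closedBall (0 : E) r ∩ S = S.subtypeL '' Metric.closedBall 0 r := by
    ext x
    simp
  rw [himage]
  exact (isCompact_closedBall 0 r).image S.subtypeL.continuous

variable {𝔸 : Type*} [NormedRing 𝔸] [NormedAlgebra ℝ 𝔸]

/-- The exponentials of the elements of `L` of norm at most `r`, playing the role of the ball of
radius `r` about `1` in the group generated by `exp L`. -/
def expBall (L : LieSubalgebra ℝ 𝔸) (r : ℝ) : Set 𝔸 :=
  exp '' (Metric.closedBall 0 r ∩ L)

variable {L : LieSubalgebra ℝ 𝔸} {r s : ℝ}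

theorem exp_mem_expBall {a : 𝔸} (ha : a ∈ L) (har : ‖a‖ ≤ r) : exp a ∈ expBall L r :=
  mem_image_of_mem _ ⟨mem_closedBall_zero_iff.2 har, ha⟩

theorem one_mem_expBall (hr : 0 ≤ r) : (1 : 𝔸) ∈ expBall L r := by
  simpa using exp_mem_expBall L.zero_mem (norm_zero.trans_le hr)

variable [CompleteSpace 𝔸] [FiniteDimensional ℝ L] {B : 𝔸 →L[ℝ] 𝔸 →L[ℝ] ℝ}

theorem isCompact_expBall : IsCompact (expBall L r) := by
  have : FiniteDimensional ℝ L.toSubmodule := ‹_›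
  exact (isCompact_closedBall_inter_submodule L.toSubmodule r).image continuous_exp

namespace IsAdInvariantInner

theorem exists_chainEnergy_lt (hB : IsAdInvariantInner L B) :
    ∃ δ > (0 : ℝ), ∀ (w : ℕ → ℝ) (n i : ℕ) (a : ℕ → 𝔸), i + 2 ≤ n →
      (∀ j, a j ∈ Metric.closedBall 0 δ ∩ (L : Set 𝔸)) → ‖a i‖ < δ → ‖a (i + 1)‖ < δ →
      (w i)⁻¹ • a i ≠ (w (i + 1))⁻¹ • a (i + 1) →
      ∃ b : ℕ → 𝔸, (∀ j, b j ∈ Metric.closedBall 0 δ ∩ (L : Set 𝔸)) ∧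
        expChain b n = expChain a n ∧ chainEnergy w n b < chainEnergy w n a := by
  obtain ⟨δ, hδ, hpair⟩ := hB.exists_energy_lt
  refine ⟨δ, hδ, fun w n i a hi ha hai hai' hne => ?_⟩
  obtain ⟨x, hx, y, hy, hxδ, hyδ, hmul, hlt⟩ :=
    hpair (w i) (w (i + 1)) (a i) (ha i).2 (a (i + 1)) (ha (i + 1)).2 hai hai' hne
  let b := Function.update (Function.update a i x) (i + 1) y
  have hbi : b i = x := by simp [b]
  have hbi' : b (i + 1) = y := by simp [b]
  have hb (j : ℕ) (hji : j ≠ i) (hji' : j ≠ i + 1) : b j = a j := by simp [b, hji, hji']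
  refine ⟨b, fun j => ?_, expChain_eq_of_adjacent hi hb (by rw [hbi, hbi', hmul]), ?_⟩
  · rcases eq_or_ne j i with rfl | hji
    · exact hbi ▸ ⟨mem_closedBall_zero_iff.2 hxδ.le, hx⟩
    rcases eq_or_ne j (i + 1) with rfl | hji'
    · exact hbi' ▸ ⟨mem_closedBall_zero_iff.2 hyδ.le, hy⟩
    · exact hb j hji hji' ▸ ha j
  · rw [← sub_neg, chainEnergy_sub_chainEnergy_of_adjacent w hi hb, hbi, hbi', sub_neg]
    exact hlt

-- The path of least energy has constant velocity, so it is a single one-parameter segment.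
theorem exists_exp_eq_expChain (hB : IsAdInvariantInner L B) :
    ∃ δ > (0 : ℝ), ∀ (w : ℕ → ℝ) (n : ℕ) (b : ℕ → 𝔸), (∀ i, 0 < w i) →
      (∀ i, b i ∈ Metric.closedBall 0 δ ∩ (L : Set 𝔸)) →
      (∀ i, w i * chainEnergy w n b < δ ^ 2) →
      ∃ c ∈ L, exp c = expChain b n ∧
        ‖c‖ ^ 2 ≤ (∑ i ∈ Finset.range n, w i) * chainEnergy w n b := by
  have : FiniteDimensional ℝ L.toSubmodule := ‹_›
  obtain ⟨δ, hδ, hshorten⟩ := hB.exists_chainEnergy_lt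
  refine ⟨δ, hδ, fun w n b hw hb hbδ => ?_⟩
  obtain ⟨a, ⟨haL, ha_chain⟩, hmin⟩ := exists_isMinOn_chainEnergy
    (isCompact_closedBall_inter_submodule L.toSubmodule δ) w n hb
  have henergy : chainEnergy w n a ≤ chainEnergy w n b := hmin ⟨hb, rfl⟩
  have haδ (i : ℕ) (hi : i < n) : ‖a i‖ < δ := by
    refine lt_of_pow_lt_pow_left₀ 2 hδ.le ((norm_sq_le_mul_chainEnergy hw hi a).trans_lt ?_)
    exact (mul_le_mul_of_nonneg_left henergy (hw i).le).trans_lt (hbδ i)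
  have hvelocity : ∀ i < n, (w i)⁻¹ • a i = (w 0)⁻¹ • a 0 := by
    intro i hi
    induction i with
    | zero => rfl
    | succ i ih =>
      rw [← ih (by omega)]
      by_contra hne
      obtain ⟨a', ha'L, ha'_chain, hlt⟩ := hshorten w n i a hi haL (haδ i (by omega))
        (haδ (i + 1) hi) (Ne.symm hne)
      exact hlt.not_ge (hmin ⟨ha'L, ha'_chain.trans ha_chain⟩)
  set x := (w 0)⁻¹ • a 0
  have ha_eq : ∀ i < n, a i = w i • x := fun i hi => by
    rw [← hvelocity i hi, smul_inv_smul₀ (hw i).ne']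
  refine ⟨(∑ i ∈ Finset.range n, w i) • x, L.smul_mem _ (L.smul_mem _ (haL 0).2), ?_, ?_⟩
  · rw [← expChain_smul, ← ha_chain, expChain_congr ha_eq]
  · have henergy_eq : chainEnergy w n a = (∑ i ∈ Finset.range n, w i) * ‖x‖ ^ 2 := by
      rw [← chainEnergy_smul hw, chainEnergy, chainEnergy]
      exact Finset.sum_congr rfl fun i hi => by rw [ha_eq i (Finset.mem_range.1 hi)]
    have hW : 0 ≤ ∑ i ∈ Finset.range n, w i := Finset.sum_nonneg fun i _ => (hw i).le
    calc ‖(∑ i ∈ Finset.range n, w i) • x‖ ^ 2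
        = (∑ i ∈ Finset.range n, w i) * chainEnergy w n a := by
          rw [norm_smul, Real.norm_of_nonneg hW, henergy_eq]; ring
      _ ≤ _ := mul_le_mul_of_nonneg_left henergy hW

theorem expChain_mem_expBall (hB : IsAdInvariantInner L B) :
    ∃ δ > (0 : ℝ), ∀ (n : ℕ) (b : ℕ → 𝔸), (∀ i, b i ≠ 0) →
      (∀ i, b i ∈ Metric.closedBall 0 δ ∩ (L : Set 𝔸)) →
      (∀ i, ‖b i‖ * ∑ j ∈ Finset.range n, ‖b j‖ < δ ^ 2) →
      expChain b n ∈ expBall L (∑ j ∈ Finset.range n, ‖b j‖) := by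
  obtain ⟨δ, hδ, hstraighten⟩ := hB.exists_exp_eq_expChain
  refine ⟨δ, hδ, fun n b hb_ne hbL hbδ => ?_⟩
  have henergy : chainEnergy (fun i => ‖b i‖) n b = ∑ j ∈ Finset.range n, ‖b j‖ :=
    Finset.sum_congr rfl fun j _ => by
      rw [sq, mul_self_div_self]
  obtain ⟨c, hcL, hc, hc_norm⟩ := hstraighten (fun i => ‖b i‖) n b
    (fun i => norm_pos_iff.2 (hb_ne i)) hbL (by simpa only [henergy] using hbδ)
  rw [henergy, ← sq] at hc_norm
  exact hc ▸ exp_mem_expBall hcL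
    (le_of_sq_le_sq hc_norm (Finset.sum_nonneg fun j _ => norm_nonneg _))

theorem exp_mul_exp_mem_expBall (hB : IsAdInvariantInner L B) {a b : 𝔸} (ha : a ∈ L)
    (hb : b ∈ L) : exp a * exp b ∈ expBall L (‖a‖ + ‖b‖) := by
  rcases eq_or_ne a 0 with rfl | ha_ne
  · simpa using exp_mem_expBall hb le_rfl
  rcases eq_or_ne b 0 with rfl | hb_ne
  · simpa using exp_mem_expBall ha le_rfl
  obtain ⟨δ, hδ, hchain⟩ := hB.expChain_mem_expBall
  obtain ⟨k, hk⟩ := exists_nat_gt (max ((‖a‖ + ‖b‖) / δ) ((‖a‖ + ‖b‖) ^ 2 / δ ^ 2))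
  have hk_pos : (0 : ℝ) < k := lt_of_le_of_lt (le_max_of_le_left (by positivity)) hk
  obtain ⟨hkδ, hkδ_sq⟩ := max_lt_iff.1 hk
  rw [div_lt_comm₀ hδ hk_pos] at hkδ
  rw [div_lt_comm₀ (by positivity) hk_pos] at hkδ_sq
  let f (i : ℕ) : 𝔸 := (k : ℝ)⁻¹ • if i < k then a else b
  have hf_norm (i : ℕ) : ‖f i‖ ≤ (‖a‖ + ‖b‖) / k := by
    rw [norm_smul, norm_inv, Real.norm_natCast, inv_mul_eq_div]
    gcongr
    split_ifs <;> simp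
  have hf_sum : ∑ i ∈ Finset.range (k + k), ‖f i‖ = ‖a‖ + ‖b‖ := by
    have hsum (z : 𝔸) : ∑ _i ∈ Finset.range k, ‖(k : ℝ)⁻¹ • z‖ = ‖z‖ := by
      simp [norm_smul, hk_pos.ne']
    rw [Finset.sum_range_add, ← hsum a, ← hsum b]
    congr 1 <;> exact Finset.sum_congr rfl fun i hi => by simp [f, Finset.mem_range.1 hi]
  rw [← expChain_append_smul_inv (Nat.cast_pos.1 hk_pos).ne', ← hf_sum]
  refine hchain (k + k) f (fun i => ?_) (fun i => ⟨?_, L.smul_mem _ ?_⟩) (fun i => ?_)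
  · exact smul_ne_zero (inv_ne_zero hk_pos.ne') (by split_ifs <;> assumption)
  · exact mem_closedBall_zero_iff.2 ((hf_norm i).trans hkδ.le)
  · split_ifs <;> assumption
  · rw [hf_sum]
    calc ‖f i‖ * (‖a‖ + ‖b‖) ≤ (‖a‖ + ‖b‖) / k * (‖a‖ + ‖b‖) := by gcongr; exact hf_norm i
      _ < δ ^ 2 := by rwa [div_mul_eq_mul_div, ← sq]

theorem mul_mem_expBall (hB : IsAdInvariantInner L B) {g h : 𝔸} (hg : g ∈ expBall L r)
    (hh : h ∈ expBall L s) : g * h ∈ expBall L (r + s) := by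
  obtain ⟨a, ⟨har, haL⟩, rfl⟩ := hg
  obtain ⟨b, ⟨hbs, hbL⟩, rfl⟩ := hh
  refine image_mono (inter_subset_inter_left _ (Metric.closedBall_subset_closedBall ?_))
    (hB.exp_mul_exp_mem_expBall haL hbL)
  exact add_le_add (mem_closedBall_zero_iff.1 har) (mem_closedBall_zero_iff.1 hbs)

end IsAdInvariantInner

end ExpBall

section LinearODE

variable {𝔸 : Type*} [NormedRing 𝔸] [NormedAlgebra ℝ 𝔸] [CompleteSpace 𝔸]

theorem norm_exp_mul_le (a y : 𝔸) : ‖exp a * y‖ ≤ Real.exp ‖a‖ * ‖y‖ := by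
  have hreal := (exp_series_hasSum_exp' (𝕂 := ℝ) ‖a‖).mul_right ‖y‖
  rw [← Real.exp_eq_exp_ℝ] at hreal
  have hbound (n : ℕ) :
      ‖((n.factorial : ℝ)⁻¹ • a ^ n) * y‖ ≤ ((n.factorial : ℝ)⁻¹ • ‖a‖ ^ n) * ‖y‖ := by
    rw [smul_mul_assoc, norm_smul, smul_mul_assoc, norm_inv, Real.norm_natCast, smul_eq_mul]
    gcongr
    induction n with
    | zero => simp
    | succ n ih =>
      rw [pow_succ', pow_succ', mul_assoc, mul_assoc]
      exact (norm_mul_le _ _).trans (mul_le_mul_of_nonneg_left ih (norm_nonneg a))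
  exact HasSum.norm_le_of_bounded ((exp_series_hasSum_exp' (𝕂 := ℝ) a).mul_right y) hreal hbound

theorem exists_norm_exp_sub_one_sub_le {ρ : ℝ} (hρ : 0 < ρ) :
    ∃ η > (0 : ℝ), ∀ a : 𝔸, ‖a‖ < η → ‖exp a - 1 - a‖ ≤ ρ * ‖a‖ := by
  have hlittleO := (hasFDerivAt_exp_zero (𝕂 := ℝ) (𝔸 := 𝔸)).isLittleO.def hρ
  obtain ⟨η, hη, hball⟩ := Metric.eventually_nhds_iff_ball.1 hlittleO
  exact ⟨η, hη, fun a ha => by simpa using hball a (mem_ball_zero_iff.2 ha)⟩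

variable {F U : ℝ → 𝔸}

theorem norm_sub_exp_integral_mul_le {s t ω ρ : ℝ} (hst : s ≤ t)
    (hF : IntervalIntegrable F volume s t) (hU : ContinuousOn U (Icc s t))
    (hUF : U t - U s = ∫ r in s..t, F r * U r) (hω : ∀ r ∈ Icc s t, ‖U r - U s‖ ≤ ω)
    (hρ : ‖exp (∫ r in s..t, F r) - 1 - ∫ r in s..t, F r‖ ≤ ρ * ∫ r in s..t, ‖F r‖) :
    ‖U t - exp (∫ r in s..t, F r) * U s‖ ≤ (ω + ρ * ‖U s‖) * ∫ r in s..t, ‖F r‖ := by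
  set a := ∫ r in s..t, F r
  rw [← uIcc_of_le hst] at hU
  have hdecomp : U t - exp a * U s =
      (∫ r in s..t, F r * (U r - U s)) - (exp a - 1 - a) * U s := by
    simp only [mul_sub]
    rw [integral_sub (hF.mul_continuousOn hU) (hF.mul_continuousOn continuousOn_const), ← hUF,
      show ∫ r in s..t, F r * U s = a * U s from
        ((ContinuousLinearMap.mul ℝ 𝔸).flip (U s)).intervalIntegral_comp_comm hF]
    noncomm_ring
  have hintegral : ‖∫ r in s..t, F r * (U r - U s)‖ ≤ ω * ∫ r in s..t, ‖F r‖ := by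
    rw [← intervalIntegral.integral_const_mul]
    refine norm_integral_le_of_norm_le hst (.of_forall fun r hr => ?_) (hF.norm.const_mul ω)
    rw [mul_comm ω]
    exact (norm_mul_le _ _).trans
      (mul_le_mul_of_nonneg_left (hω r (Ioc_subset_Icc_self hr)) (norm_nonneg _))
  calc ‖U t - exp a * U s‖
      ≤ ω * (∫ r in s..t, ‖F r‖) + ρ * (∫ r in s..t, ‖F r‖) * ‖U s‖ := by
        rw [hdecomp]
        refine (norm_sub_le _ _).trans (add_le_add hintegral ((norm_mul_le _ _).trans ?_))
        gcongr
    _ = (ω + ρ * ‖U s‖) * ∫ r in s..t, ‖F r‖ := by ring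

theorem exists_integral_norm_lt {E : Type*} [NormedAddCommGroup E] {f : ℝ → E} {T : ℝ} (hT : 0 ≤ T)
    (hf : IntervalIntegrable f volume 0 T) {ε : ℝ} (hε : 0 < ε) :
    ∃ η > (0 : ℝ), ∀ s t : ℝ, 0 ≤ s → s ≤ t → t ≤ T → t - s < η → ∫ r in s..t, ‖f r‖ < ε := by
  have hprimitive := continuousOn_primitive_interval' hf.norm left_mem_uIcc
  obtain ⟨η, hη, hunif⟩ := Metric.uniformContinuousOn_iff.1
    (isCompact_uIcc.uniformContinuousOn_of_continuous hprimitive) ε hε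
  rw [uIcc_of_le hT] at hunif
  refine ⟨η, hη, fun s t hs hst ht hst_lt => ?_⟩
  have hint {r : ℝ} (hr : r ∈ Icc 0 T) : IntervalIntegrable (fun r => ‖f r‖) volume 0 r :=
    hf.norm.mono_set (uIcc_subset_uIcc left_mem_uIcc (by rwa [uIcc_of_le hT]))
  have hs_mem : s ∈ Icc 0 T := ⟨hs, hst.trans ht⟩
  have ht_mem : t ∈ Icc 0 T := ⟨hs.trans hst, ht⟩
  rw [← integral_interval_sub_left (hint ht_mem) (hint hs_mem)]
  refine (le_abs_self _).trans_lt (hunif t ht_mem s hs_mem ?_)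
  rwa [Real.dist_eq, abs_of_nonneg (sub_nonneg.2 hst)]

theorem exists_norm_sub_exp_integral_mul_le {T : ℝ} (hT : 0 ≤ T)
    (hF : IntervalIntegrable F volume 0 T) (hU : ContinuousOn U (Icc 0 T)) {x₀ : 𝔸}
    (hUF : ∀ t ∈ Icc 0 T, U t = x₀ + ∫ r in (0 : ℝ)..t, F r * U r) {ε : ℝ} (hε : 0 < ε) :
    ∃ η > (0 : ℝ), ∀ s t : ℝ, 0 ≤ s → s ≤ t → t ≤ T → t - s < η →
      ‖U t - exp (∫ r in s..t, F r) * U s‖ ≤ ε * ∫ r in s..t, ‖F r‖ := by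
  obtain ⟨M, hM⟩ := isCompact_Icc.exists_bound_of_continuousOn hU
  have hM_nonneg : 0 ≤ M := (norm_nonneg _).trans (hM 0 (left_mem_Icc.2 hT))
  let ρ := ε / (2 * (M + 1))
  obtain ⟨η₀, hη₀, hexp⟩ := exists_norm_exp_sub_one_sub_le (𝔸 := 𝔸) (ρ := ρ) (by positivity)
  obtain ⟨η₁, hη₁, hU_unif⟩ := Metric.uniformContinuousOn_iff.1
    (isCompact_Icc.uniformContinuousOn_of_continuous hU) (ε / 2) (by positivity)
  obtain ⟨η₂, hη₂, hF_small⟩ := exists_integral_norm_lt hT hF hη₀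
  refine ⟨min η₁ η₂, lt_min hη₁ hη₂, fun s t hs hst ht hη => ?_⟩
  have hs_mem : s ∈ Icc 0 T := ⟨hs, hst.trans ht⟩
  have ht_mem : t ∈ Icc 0 T := ⟨hs.trans hst, ht⟩
  have hsub {r : ℝ} (hr : r ∈ Icc 0 T) : IntervalIntegrable F volume 0 r :=
    hF.mono_set (uIcc_subset_uIcc left_mem_uIcc (by rwa [uIcc_of_le hT]))
  have hsubU {r : ℝ} (hr : r ∈ Icc 0 T) : IntervalIntegrable (fun r => F r * U r) volume 0 r :=
    (hsub hr).mul_continuousOn (hU.mono (by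
      rw [uIcc_of_le hr.1]; exact Icc_subset_Icc_right hr.2))
  have hF_lt := hF_small s t hs hst ht (hη.trans_le (min_le_right ..))
  have ha : ‖∫ r in s..t, F r‖ ≤ ∫ r in s..t, ‖F r‖ := norm_integral_le_integral_norm hst
  refine (norm_sub_exp_integral_mul_le (ω := ε / 2) (ρ := ρ) hst
    ((hsub hs_mem).symm.trans (hsub ht_mem)) (hU.mono (Icc_subset_Icc hs ht)) ?_ ?_ ?_).trans ?_
  · rw [hUF t ht_mem, hUF s hs_mem, add_sub_add_left_eq_sub,
      integral_interval_sub_left (hsubU ht_mem) (hsubU hs_mem)]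
  · intro r hr
    rw [← dist_eq_norm]
    refine (hU_unif r ⟨hs.trans hr.1, hr.2.trans ht⟩ s hs_mem ?_).le
    rw [Real.dist_eq, abs_of_nonneg (sub_nonneg.2 hr.1)]
    linarith [hr.2, hη.trans_le (min_le_left ..)]
  · exact (hexp _ (ha.trans_lt hF_lt)).trans (by gcongr)
  · have hρM : ρ * ‖U s‖ ≤ ε / 2 := by
      calc ρ * ‖U s‖ ≤ ρ * (M + 1) := by gcongr; exact (hM s hs_mem).trans (by simp)
        _ = ε / 2 := by simp only [ρ]; field
    gcongr
    · exact integral_nonneg hst fun r _ => norm_nonneg _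
    · linarith

end LinearODE

theorem induction_of_short_steps {T η : ℝ} (hT : 0 ≤ T) (hη : 0 < η) {p : ℝ → Prop} (zero : p 0)
    (step : ∀ s t, 0 ≤ s → s ≤ t → t ≤ T → t - s < η → p s → p t) : p T := by
  obtain ⟨N, hN⟩ := exists_nat_gt (T / η)
  have hN_pos : (0 : ℝ) < N := lt_of_le_of_lt (by positivity) hN
  have hstep_lt : T / N < η := (div_lt_comm₀ hη hN_pos).1 hN
  have hgrid (k : ℕ) (hk : k ≤ N) : p (k * (T / N)) := by
    induction k with
    | zero => simpa using zero
    | succ k ih =>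
      have hk_real : (k + 1 : ℝ) ≤ N := mod_cast hk
      have hstep_nonneg : 0 ≤ T / N := by positivity
      refine step _ _ (by positivity) ?_ ?_ ?_ (ih (by omega)) <;> push_cast
      · linarith
      · calc (k + 1 : ℝ) * (T / N) ≤ N * (T / N) := by gcongr
          _ = T := by field
      · linarith
  simpa [mul_div_cancel₀ T hN_pos.ne'] using hgrid N le_rfl

section Endpoint

variable {𝔸 : Type*} [NormedRing 𝔸] [NormedAlgebra ℝ 𝔸] [CompleteSpace 𝔸]
  {L : LieSubalgebra ℝ 𝔸} [FiniteDimensional ℝ L] {B : 𝔸 →L[ℝ] 𝔸 →L[ℝ] ℝ}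
  {F U : ℝ → 𝔸} {T : ℝ}

namespace IsAdInvariantInner

theorem exists_expBall_norm_sub_le (hB : IsAdInvariantInner L B) (hT : 0 ≤ T)
    (hFL : ∀ t ∈ Icc 0 T, F t ∈ L) (hF : IntervalIntegrable F volume 0 T)
    (hU : ContinuousOn U (Icc 0 T)) (hUF : ∀ t ∈ Icc 0 T, U t = 1 + ∫ s in (0 : ℝ)..t, F s * U s)
    {ε : ℝ} (hε : 0 < ε) :
    ∃ g ∈ expBall L (∫ t in (0 : ℝ)..T, ‖F t‖),
      ‖U T - g‖ ≤ ε * ((∫ t in (0 : ℝ)..T, ‖F t‖) * Real.exp (∫ t in (0 : ℝ)..T, ‖F t‖)) := by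
  have : FiniteDimensional ℝ L.toSubmodule := ‹_›
  obtain ⟨η, hη, hstep⟩ := exists_norm_sub_exp_integral_mul_le hT hF hU hUF hε
  let ℓ (t : ℝ) := ∫ s in (0 : ℝ)..t, ‖F s‖
  refine induction_of_short_steps (p := fun t => ∃ g ∈ expBall L (ℓ t),
    ‖U t - g‖ ≤ ε * (ℓ t * Real.exp (ℓ t))) hT hη ?_ ?_
  · exact ⟨1, one_mem_expBall (by simp [ℓ]), by simp [ℓ, hUF 0 (left_mem_Icc.2 hT)]⟩
  rintro s t hs hst ht htη ⟨g, hg, hUg⟩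
  have hsub : uIcc s t ⊆ uIcc 0 T := by
    rw [uIcc_of_le hst, uIcc_of_le hT]
    exact Icc_subset_Icc hs ht
  have hF_st : IntervalIntegrable F volume s t := hF.mono_set hsub
  let a := ∫ r in s..t, F r
  let Δ := ∫ r in s..t, ‖F r‖
  have haL : a ∈ L := intervalIntegral_mem_submodule (S := L.toSubmodule)
    (fun r hr => hFL r (by simpa [uIcc_of_le hT] using hsub hr)) hF_st
  have ha : ‖a‖ ≤ Δ := norm_integral_le_integral_norm hst
  have hΔ : 0 ≤ Δ := (norm_nonneg a).trans ha
  have hℓ_nonneg : 0 ≤ ℓ s := integral_nonneg hs fun r _ => norm_nonneg _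
  have hℓ : ℓ t = Δ + ℓ s := by
    rw [add_comm]
    refine (integral_add_adjacent_intervals (hF.norm.mono_set ?_) hF_st.norm).symm
    exact uIcc_subset_uIcc left_mem_uIcc (hsub left_mem_uIcc)
  refine ⟨exp a * g, hℓ ▸ hB.mul_mem_expBall (exp_mem_expBall haL ha) hg, ?_⟩
  calc ‖U t - exp a * g‖ ≤ ‖U t - exp a * U s‖ + ‖exp a * (U s - g)‖ := by
        rw [mul_sub]
        exact norm_sub_le_norm_sub_add_norm_sub ..
    _ ≤ ε * Δ + Real.exp Δ * (ε * (ℓ s * Real.exp (ℓ s))) := by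
        refine add_le_add (hstep s t hs hst ht htη) ((norm_exp_mul_le _ _).trans ?_)
        gcongr
    _ = ε * (Δ + ℓ s * Real.exp (Δ + ℓ s)) := by rw [Real.exp_add]; ring
    _ ≤ ε * (Δ * Real.exp (Δ + ℓ s) + ℓ s * Real.exp (Δ + ℓ s)) := by
        gcongr
        exact le_mul_of_one_le_right hΔ (Real.one_le_exp (by positivity))
    _ = ε * (ℓ t * Real.exp (ℓ t)) := by rw [hℓ, add_mul]

theorem endpoint_mem_expBall (hB : IsAdInvariantInner L B) (hT : 0 ≤ T)
    (hFL : ∀ t ∈ Icc 0 T, F t ∈ L) (hF : IntervalIntegrable F volume 0 T)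
    (hU : ContinuousOn U (Icc 0 T))
    (hUF : ∀ t ∈ Icc 0 T, U t = 1 + ∫ s in (0 : ℝ)..t, F s * U s) :
    U T ∈ expBall L (∫ t in (0 : ℝ)..T, ‖F t‖) := by
  rw [← isCompact_expBall.isClosed.closure_eq, Metric.mem_closure_iff]
  intro r hr
  let ℓ := ∫ t in (0 : ℝ)..T, ‖F t‖
  have hℓ : 0 ≤ ℓ * Real.exp ℓ :=
    mul_nonneg (integral_nonneg hT fun t _ => norm_nonneg _) (Real.exp_pos ℓ).le
  obtain ⟨g, hg, hUg⟩ := hB.exists_expBall_norm_sub_le hT hFL hF hU hUF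
    (ε := r / (ℓ * Real.exp ℓ + 1)) (by positivity)
  refine ⟨g, hg, dist_eq_norm (U T) g ▸ hUg.trans_lt ?_⟩
  rw [div_mul_eq_mul_div, div_lt_iff₀ (by positivity)]
  exact mul_lt_mul_of_pos_left (lt_add_one _) hr

end IsAdInvariantInner

end Endpoint

section SkewAdjoint

variable {A : Type*} [Ring A] [StarRing A] [Algebra ℝ A] [StarModule ℝ A]

theorem mem_skewAdjoint_of_mem_lieSpan {s : Set A} (hs : s ⊆ skewAdjoint A) {x : A}
    (hx : x ∈ LieSubalgebra.lieSpan ℝ A s) : x ∈ skewAdjoint A := by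
  induction hx using LieSubalgebra.lieSpan_induction with
  | mem x hx => exact hs hx
  | zero => exact zero_mem _
  | add x y _ _ hx hy => exact add_mem hx hy
  | smul c x _ hx => exact skewAdjoint.smul_mem c hx
  | lie x y _ _ hx hy =>
    rw [skewAdjoint.mem_iff] at hx hy ⊢
    rw [LieRing.of_associative_ring_bracket, star_sub, star_mul, star_mul, hx, hy]
    noncomm_ring

end SkewAdjoint

section FrobeniusForm

attribute [local instance] Matrix.frobeniusNormedRing Matrix.frobeniusNormedAlgebra
  Matrix.frobeniusNormedAddCommGroup Matrix.frobeniusNormedSpace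

variable {n : Type*} [Fintype n] [DecidableEq n]

/-- The real bilinear form `(A, B) ↦ Re tr (A† B)`, the inner product of the Frobenius norm. -/
noncomputable def frobeniusForm : Matrix n n ℂ →L[ℝ] Matrix n n ℂ →L[ℝ] ℝ :=
  LinearMap.toContinuousLinearMap (LinearMap.toContinuousLinearMap.toLinearMap ∘ₗ
    LinearMap.mk₂ ℝ (fun A B : Matrix n n ℂ => (A.conjTranspose * B).trace.re)
      (fun A A' B => by simp [Matrix.add_mul])
      (fun c A B => by simp [Matrix.trace_smul])
      (fun A B B' => by simp [Matrix.mul_add])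
      (fun c A B => by simp [Matrix.trace_smul]))

theorem frobeniusForm_apply (A B : Matrix n n ℂ) :
    frobeniusForm A B = (A.conjTranspose * B).trace.re := rfl

theorem frobeniusForm_self (A : Matrix n n ℂ) : frobeniusForm A A = ‖A‖ ^ 2 := by
  have htrace : frobeniusForm A A = ∑ i, ∑ j, ‖A i j‖ ^ 2 := by
    simp_rw [frobeniusForm_apply, Matrix.trace, Matrix.diag, Matrix.mul_apply,
      Matrix.conjTranspose_apply, Complex.re_sum]
    rw [Finset.sum_comm]
    refine Finset.sum_congr rfl fun i _ => Finset.sum_congr rfl fun j _ => ?_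
    rw [Complex.sq_norm, Complex.normSq_apply]
    simp
  rw [htrace, Matrix.frobenius_norm_def, ← Real.sqrt_eq_rpow, Real.sq_sqrt (by positivity)]
  simp only [Real.rpow_two]

theorem frobeniusForm_comm (A B : Matrix n n ℂ) : frobeniusForm A B = frobeniusForm B A := by
  rw [frobeniusForm_apply, frobeniusForm_apply, ← Complex.conj_re, ← Complex.star_def,
    ← Matrix.trace_conjTranspose, Matrix.conjTranspose_mul, Matrix.conjTranspose_conjTranspose]

theorem frobeniusForm_lie_self {A : Matrix n n ℂ} (hA : A ∈ skewAdjoint (Matrix n n ℂ))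
    (B : Matrix n n ℂ) : frobeniusForm A ⁅A, B⁆ = 0 := by
  have htrace : (A * (B * A)).trace = (A * (A * B)).trace := by
    rw [← Matrix.mul_assoc, Matrix.trace_mul_comm]
  rw [frobeniusForm_apply, ← Matrix.star_eq_conjTranspose, skewAdjoint.mem_iff.1 hA,
    LieRing.of_associative_ring_bracket]
  simp [Matrix.mul_sub, htrace]

theorem isAdInvariantInner_frobeniusForm {L : LieSubalgebra ℝ (Matrix n n ℂ)}
    (hL : ∀ A ∈ L, A ∈ skewAdjoint (Matrix n n ℂ)) : IsAdInvariantInner L frobeniusForm where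
  apply_self A _ := frobeniusForm_self A
  symm A _ B _ := frobeniusForm_comm A B
  apply_lie_self A hA B _ := frobeniusForm_lie_self (hL A hA) B

theorem frobeniusNorm_eq_norm {D : ℕ} (A : Matrix (Fin D) (Fin D) ℂ) : frobeniusNorm A = ‖A‖ := by
  rw [frobeniusNorm, ← frobeniusForm_apply, frobeniusForm_self, Real.sqrt_sq (norm_nonneg A)]

end FrobeniusForm

section QuantumControl

attribute [local instance] Matrix.frobeniusNormedRing Matrix.frobeniusNormedAlgebra
  Matrix.frobeniusNormedAddCommGroup Matrix.frobeniusNormedSpace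

-- The topology of the Frobenius norm and the entrywise one agree only after unfolding; the higher
-- priority keeps instance search on the former.
attribute [local instance 2000] PseudoMetricSpace.toUniformSpace UniformSpace.toTopologicalSpace

variable {D M : ℕ} {H : Fin (M + 1) → Matrix (Fin D) (Fin D) ℂ} {V : Matrix (Fin D) (Fin D) ℂ}

theorem mem_skewAdjoint_of_mem_dynamicalLieAlgebra (hH : ∀ m, (H m).IsHermitian)
    {A : Matrix (Fin D) (Fin D) ℂ} (hA : A ∈ dynamicalLieAlgebra H) :
    A ∈ skewAdjoint (Matrix (Fin D) (Fin D) ℂ) := by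
  refine mem_skewAdjoint_of_mem_lieSpan ?_ hA
  rintro _ ⟨m, rfl⟩
  exact (hH m).isSelfAdjoint.smul_mem_skewAdjoint Complex.conj_I

theorem I_smul_hamiltonian_mem_dynamicalLieAlgebra (H : Fin (M + 1) → Matrix (Fin D) (Fin D) ℂ)
    (h : Fin (M + 1) → ℝ → ℝ) (t : ℝ) :
    Complex.I • hamiltonian H h t ∈ dynamicalLieAlgebra H := by
  rw [hamiltonian, Finset.smul_sum]
  refine sum_mem fun m _ => ?_
  rw [smul_comm, Complex.coe_smul]
  exact (dynamicalLieAlgebra H).smul_mem _ (LieSubalgebra.subset_lieSpan ⟨m, rfl⟩)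

theorem exists_mem_hermitianGenerators_of_mem_expBall (hH : ∀ m, (H m).IsHermitian) {r : ℝ}
    (hV : V ∈ expBall (dynamicalLieAlgebra H) r) :
    ∃ C ∈ hermitianGenerators H V, frobeniusNorm C ≤ r := by
  obtain ⟨X, ⟨hXr, hX⟩, rfl⟩ := hV
  have hIX : Complex.I • Complex.I • X = -X := by
    rw [smul_smul, Complex.I_mul_I, neg_one_smul]
  refine ⟨Complex.I • X, ⟨?_, ?_, ?_⟩, ?_⟩
  · have hX_star := skewAdjoint.mem_iff.1 (mem_skewAdjoint_of_mem_dynamicalLieAlgebra hH hX)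
    rw [Matrix.IsHermitian, Matrix.conjTranspose_smul, ← Matrix.star_eq_conjTranspose, hX_star]
    simp
  · rw [hIX, neg_neg]
    rfl
  · rw [hIX]
    exact (dynamicalLieAlgebra H).neg_mem hX
  · rw [frobeniusNorm_eq_norm, norm_smul, Complex.norm_I, one_mul]
    exact mem_closedBall_zero_iff.1 hXr

theorem isClosed_hermitianGenerators : IsClosed (hermitianGenerators H V) := by
  have hHermitian : IsClosed {C : Matrix (Fin D) (Fin D) ℂ | C.IsHermitian} :=
    isClosed_eq continuous_id.matrix_conjTranspose continuous_id
  have hexp : IsClosed {C : Matrix (Fin D) (Fin D) ℂ | exp (-(Complex.I • C)) = V} :=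
    isClosed_eq (continuous_exp.comp (continuous_id.const_smul Complex.I).neg) continuous_const
  have hmem : IsClosed ((dynamicalLieAlgebra H).toSubmodule : Set (Matrix (Fin D) (Fin D) ℂ)) :=
    Submodule.closed_of_finiteDimensional _
  exact hHermitian.inter (hexp.inter (hmem.preimage (continuous_id.const_smul Complex.I)))

theorem exists_isLeast_frobeniusNorm_hermitianGenerators
    (hne : (hermitianGenerators H V).Nonempty) :
    ∃ c, IsLeast (frobeniusNorm '' hermitianGenerators H V) c := by
  have : ProperSpace (Matrix (Fin D) (Fin D) ℂ) := FiniteDimensional.proper ℝ _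
  obtain ⟨C, hC, hdist⟩ := isClosed_hermitianGenerators.exists_infDist_eq_dist hne 0
  refine ⟨frobeniusNorm C, mem_image_of_mem _ hC, forall_mem_image.2 fun C' hC' => ?_⟩
  rw [frobeniusNorm_eq_norm, frobeniusNorm_eq_norm, ← dist_zero_left, ← dist_zero_left, ← hdist]
  exact Metric.infDist_le_dist_of_mem hC'

theorem frobeniusNorm_pos_of_mem_hermitianGenerators {C : Matrix (Fin D) (Fin D) ℂ}
    (hC : C ∈ hermitianGenerators H V) (hV : V ≠ 1) : 0 < frobeniusNorm C := by
  rw [frobeniusNorm_eq_norm, norm_pos_iff]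
  rintro rfl
  exact hV (by simpa using hC.2.1.symm)

theorem exists_mem_hermitianGenerators_frobeniusNorm_le (hH : ∀ m, (H m).IsHermitian)
    {h : Fin (M + 1) → ℝ → ℝ} {T : ℝ} (hT : 0 ≤ T)
    (hint : IntervalIntegrable (hamiltonian H h) volume 0 T) {U : ℝ → Matrix (Fin D) (Fin D) ℂ}
    (hU : ContinuousOn U (Icc 0 T))
    (hUH : ∀ t ∈ Icc 0 T, U t = 1 + ∫ s in (0 : ℝ)..t, -(Complex.I • hamiltonian H h s) * U s) :
    ∃ C ∈ hermitianGenerators H (U T),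
      frobeniusNorm C ≤ ∫ t in (0 : ℝ)..T, frobeniusNorm (hamiltonian H h t) := by
  refine exists_mem_hermitianGenerators_of_mem_expBall hH ?_
  have hB : IsAdInvariantInner (dynamicalLieAlgebra H) frobeniusForm :=
    isAdInvariantInner_frobeniusForm fun A => mem_skewAdjoint_of_mem_dynamicalLieAlgebra hH
  have : FiniteDimensional ℝ (dynamicalLieAlgebra H) :=
    inferInstanceAs (FiniteDimensional ℝ (dynamicalLieAlgebra H).toSubmodule)
  simpa [frobeniusNorm_eq_norm, norm_smul] using hB.endpoint_mem_expBall hT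
    (fun t _ => (dynamicalLieAlgebra H).neg_mem (I_smul_hamiltonian_mem_dynamicalLieAlgebra H h t))
    (hint.smul Complex.I).neg hU hUH

theorem IsPiecewiseContinuous.intervalIntegrable {F : ℝ → Matrix (Fin D) (Fin D) ℂ} {T : ℝ}
    (hT : 0 ≤ T) (hF : IsPiecewiseContinuous F T) : IntervalIntegrable F volume 0 T := by
  obtain ⟨⟨K, hK⟩, S, hS, (hcont : ContinuousOn F (Icc 0 T \ S))⟩ := hF
  have hmeas : MeasurableSet (Icc 0 T \ S) := measurableSet_Icc.diff hS.measurableSet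
  have hdiff : IntegrableOn F (Icc 0 T \ S) := by
    refine IntegrableOn.of_bound ((measure_mono sdiff_subset).trans_lt measure_Icc_lt_top)
      (hcont.aestronglyMeasurable hmeas) K ?_
    filter_upwards [ae_restrict_mem hmeas] with t ht
    exact frobeniusNorm_eq_norm (F t) ▸ hK t ht.1
  rw [intervalIntegrable_iff_integrableOn_Icc_of_le hT]
  exact hdiff.congr_set_ae (sdiff_null_ae_eq_self (hS.measure_zero volume)).symm

theorem IsSchrodingerSolution.eq_one_add_integral {F U : ℝ → Matrix (Fin D) (Fin D) ℂ} {T : ℝ}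
    (hU : IsSchrodingerSolution F T U) (hF : IntervalIntegrable F volume 0 T) {t : ℝ}
    (ht : t ∈ Icc 0 T) : U t = 1 + ∫ s in (0 : ℝ)..t, -(Complex.I • F s) * U s := by
  obtain ⟨hU_zero, hU_cont, S, hS, hU_deriv⟩ := hU
  have hsub : Icc 0 t ⊆ Icc 0 T := Icc_subset_Icc_right ht.2
  have hcont := hU_cont.mono hsub
  have hint : IntervalIntegrable (fun s => -(Complex.I • F s) * U s) volume 0 t := by
    refine IntervalIntegrable.mul_continuousOn (hF.mono_set ?_ |>.smul Complex.I).neg ?_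
    · rwa [uIcc_of_le ht.1, uIcc_of_le (ht.1.trans ht.2)]
    · rwa [uIcc_of_le ht.1]
  rw [integral_eq_of_hasDerivAt_off_countable_of_le U _ ht.1 hS.countable hcont ?_ hint, hU_zero,
    add_sub_cancel]
  intro s hs
  have hs_mem : s ∈ Ioo 0 T := Ioo_subset_Ioo_right ht.2 hs.1
  obtain ⟨U', hU', hI⟩ := hU_deriv s ⟨Ioo_subset_Icc_self hs_mem, hs.2⟩
  refine (hU'.hasDerivAt (Icc_mem_nhds hs_mem.1 hs_mem.2)).congr_deriv ?_
  rw [neg_mul, smul_mul_assoc, ← hI, smul_smul, Complex.I_mul_I, neg_one_smul, neg_neg]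

theorem theorem1_general {D M : ℕ} (H : Fin (M + 1) → Matrix (Fin D) (Fin D) ℂ)
    (hH : ∀ m, (H m).IsHermitian) (h : Fin (M + 1) → ℝ → ℝ) (T : ℝ) (hT : 0 ≤ T)
    (hint : IntervalIntegrable (hamiltonian H h) volume 0 T)
    (U : ℝ → Matrix (Fin D) (Fin D) ℂ) (hU : ContinuousOn U (Icc 0 T))
    (hUH : ∀ t ∈ Icc 0 T, U t = 1 + ∫ s in (0 : ℝ)..t, -(Complex.I • hamiltonian H h s) * U s) :
    IntervalIntegrable (fun t => frobeniusNorm (hamiltonian H h t)) volume 0 T ∧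
    (∃ C : Matrix (Fin D) (Fin D) ℂ,
      C.IsHermitian ∧
      exp (-(Complex.I • C)) = U T ∧
      Complex.I • C ∈ dynamicalLieAlgebra H ∧
      frobeniusNorm C ≤ ∫ t in (0 : ℝ)..T, frobeniusNorm (hamiltonian H h t)) ∧
    (∃ c : ℝ, IsLeast (frobeniusNorm '' hermitianGenerators H (U T)) c ∧
      ∀ K : ℝ, (∀ t ∈ Icc (0 : ℝ) T, frobeniusNorm (hamiltonian H h t) ≤ K) →
        c ≤ K * T ∧ (U T ≠ 1 → 0 < K ∧ c / K ≤ T)) := by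
  have hint_norm : IntervalIntegrable (fun t => frobeniusNorm (hamiltonian H h t)) volume 0 T := by
    simpa only [frobeniusNorm_eq_norm] using hint.norm
  obtain ⟨C, hC, hC_le⟩ := exists_mem_hermitianGenerators_frobeniusNorm_le hH hT hint hU hUH
  obtain ⟨c, hc⟩ := exists_isLeast_frobeniusNorm_hermitianGenerators ⟨C, hC⟩
  refine ⟨hint_norm, ⟨C, hC.1, hC.2.1, hC.2.2, hC_le⟩, c, hc, fun K hK => ?_⟩
  have hcK : c ≤ K * T := by
    calc c ≤ frobeniusNorm C := hc.2 (mem_image_of_mem _ hC)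
      _ ≤ ∫ t in (0 : ℝ)..T, frobeniusNorm (hamiltonian H h t) := hC_le
      _ ≤ ∫ _ in (0 : ℝ)..T, K := integral_mono_on hT hint_norm intervalIntegrable_const hK
      _ = K * T := by simp [mul_comm]
  refine ⟨hcK, fun hUT => ?_⟩
  obtain ⟨C₀, hC₀, rfl⟩ := hc.1
  have hK_pos : 0 < K := pos_of_mul_pos_left
    ((frobeniusNorm_pos_of_mem_hermitianGenerators hC₀ hUT).trans_le hcK) hT
  exact ⟨hK_pos, (div_le_iff₀' hK_pos).2 hcK⟩

end QuantumControl

end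

theorem theorem1 {D M : ℕ} (H : Fin (M + 1) → Matrix (Fin D) (Fin D) ℂ)
    (hH : ∀ m, (H m).IsHermitian) (h : Fin (M + 1) → ℝ → ℝ) (T : ℝ) (hT : 0 ≤ T)
    (hpc : IsPiecewiseContinuous (hamiltonian H h) T)
    (U : ℝ → Matrix (Fin D) (Fin D) ℂ) (hU : IsSchrodingerSolution (hamiltonian H h) T U) :
    IntervalIntegrable (fun t => frobeniusNorm (hamiltonian H h t)) MeasureTheory.volume 0 T ∧
    (∃ C : Matrix (Fin D) (Fin D) ℂ,
      C.IsHermitian ∧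
      NormedSpace.exp (-(Complex.I • C)) = U T ∧
      Complex.I • C ∈ dynamicalLieAlgebra H ∧
      frobeniusNorm C ≤ ∫ t in (0 : ℝ)..T, frobeniusNorm (hamiltonian H h t)) ∧
    (∃ c : ℝ, IsLeast (frobeniusNorm '' hermitianGenerators H (U T)) c ∧
      ∀ K : ℝ, (∀ t ∈ Set.Icc (0 : ℝ) T, frobeniusNorm (hamiltonian H h t) ≤ K) →
        c ≤ K * T ∧ (U T ≠ 1 → 0 < K ∧ c / K ≤ T)) :=
  theorem1_general H hH h T hT (hpc.intervalIntegrable hT) U hU.2.1 fun _ ht =>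
    hU.eq_one_add_integral (hpc.intervalIntegrable hT) ht
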